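/- Let $\mathbb B=\{0,1\}$ and let $\Omega=\bigcup_{n\ge 1}\mathbb B^{\mathbb B^n}$ be the set of Boolean functions of positive arity. For an $m$-ary $g$ and an $n$-ary $f$ put $g\le f$ if $g=f(p_1,\dots,p_n)$ for some $m$-ary projections $p_1,\dots,p_n$; this is a quasi-order. Let $\equiv$ be the associated equivalence and $(\Omega/\equiv,\sqsubseteq)$ the associated poset. A functional equation is an expression $$h_1(\mathbf f(g_1(\mathbf x_1,\dots,\mathbf x_p)),\dots,\mathbf f(g_m(\mathbf x_1,\dots,\mathbf x_p)))=h_2(\mathbf f(g'_1(\mathbf x_1,\dots,\mathbf x_p)),\dots,\mathbf f(g'_t(\mathbf x_1,\dots,\mathbf x_p)))$$ with $m,t,p\ge 1$, $h_1:\mathbb B^m\to\mathbb B$, $h_2:\mathbb B^t\to\mathbb B$, $g_i,g'_j:\mathbb B^p\to\mathbb B$; an $n$-ary $f$ satisfies it if equality holds for all values of $\mathbf x_1,\dots,\mathbf x_p$ in $\mathbb B^n$, the maps $g_i,g'_j$ being applied component-wise. Let $\mathcal F$ be the set of all classes $K\subseteq\Omega$ which can be defined by finitely many functional equations; with union and intersection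 it is a bounded distributive lattice. The Priestley space of a bounded distributive lattice $T$ is the set of prime filters of $T$, ordered by inclusion and equipped with the topology induced by the product topology on $\mathfrak P(T)=\{0,1\}^T$ ($\{0,1\}$ discrete). An ideal of a poset is a non-empty up-directed initial segment. **Theorem.** The Priestley space of the lattice $\mathcal F$ ordered by reverse inclusion is (isomorphic, by an order isomorphism which is a homeomorphism, to) the set $\mathcal J(\Omega/\equiv,\sqsubseteq)$ of ideals of $(\Omega/\equiv,\sqsubseteq)$, ordered by inclusion and equipped with the topology induced by the product topology on $\mathfrak P(\Omega/\equiv)$. The isomorphism sends an ideal $J$ to the prime filter of all $K\in\mathcal F$ such that some $f\in\Omega\setminus K$ has its equivalence class in $J$. -/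

import Mathlib

/-- The set `Ω` of Boolean functions: maps `𝔹ⁿ → 𝔹` of some positive arity `n`. -/
structure BoolFun where
  /-- the number `n` of variables -/
  arity : ℕ
  arity_pos : 1 ≤ arity
  /-- the map `𝔹ⁿ → 𝔹` -/
  toFun : (Fin arity → Bool) → Bool

/-- The `i`-th `n`-ary projection. -/
def boolProj {n : ℕ} (i : Fin n) : (Fin n → Bool) → Bool := fun a => a i

/-- `g ≤ f` when `g` is obtained from `f` by simple variable substitution:
`g = f(p₁, …, pₙ)` for some projections `p₁, …, pₙ` of the arity of `g`. -/
instance : LE BoolFun where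
  le g f := ∃ σ : Fin f.arity → Fin g.arity, ∀ a, g.toFun a = f.toFun (fun i => boolProj (σ i) a)

instance : Preorder BoolFun where
  le_refl f := ⟨id, fun _ => rfl⟩
  le_trans := by
    rintro f g h ⟨σ, hσ⟩ ⟨τ, hτ⟩
    refine ⟨fun i => σ (τ i), fun a => ?_⟩
    rw [hσ, hτ]
    rfl

/-- The poset `(Ω/≡, ⊑)` associated with the quasi-ordered set `(Ω, ≤)`, where `f ≡ g` means
`f ≤ g` and `g ≤ f`. -/
abbrev BoolFunClasses : Type := Antisymmetrization BoolFun (· ≤ ·)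

/-- A functional equation
`h₁(f(g₁(x₁,…,xₚ)),…,f(gₘ(x₁,…,xₚ))) = h₂(f(g'₁(x₁,…,xₚ)),…,f(g'ₜ(x₁,…,xₚ)))`. -/
structure FunctionalEquation where
  m : ℕ
  t : ℕ
  p : ℕ
  m_pos : 1 ≤ m
  t_pos : 1 ≤ t
  p_pos : 1 ≤ p
  h₁ : (Fin m → Bool) → Bool
  h₂ : (Fin t → Bool) → Bool
  g : Fin m → (Fin p → Bool) → Bool
  g' : Fin t → (Fin p → Bool) → Bool

/-- An `n`-ary `f` satisfies the equation if the two sides agree for all `v₁, …, vₚ ∈ 𝔹ⁿ`,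
the inner maps `gᵢ`, `g'ᵢ` being applied component-wise. -/
def BoolFun.Satisfies (f : BoolFun) (e : FunctionalEquation) : Prop :=
  ∀ v : Fin e.p → Fin f.arity → Bool,
    e.h₁ (fun i => f.toFun (fun k => e.g i (fun j => v j k))) =
      e.h₂ (fun i => f.toFun (fun k => e.g' i (fun j => v j k)))

/-- The class of Boolean functions defined by a set of functional equations. -/
def definedBy (E : Set FunctionalEquation) : Set BoolFun := {f | ∀ e ∈ E, f.Satisfies e}

/-- `K` can be defined by finitely many functional equations. -/
def FinitelyDefinable (K : Set BoolFun) : Prop :=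
  ∃ E : Set FunctionalEquation, E.Finite ∧ definedBy E = K

/-- An equation expressing that `a` or `b` holds (with disjoint sets of vector variables). -/
def FunctionalEquation.or (a b : FunctionalEquation) : FunctionalEquation where
  m := (a.m + a.t) + (b.m + b.t)
  t := 1
  p := a.p + b.p
  m_pos := by have := a.m_pos; omega
  t_pos := le_rfl
  p_pos := by have := a.p_pos; omega
  h₁ y :=
    (a.h₁ (fun i => y (Fin.castAdd _ (Fin.castAdd _ i))) ==
      a.h₂ (fun i => y (Fin.castAdd _ (Fin.natAdd _ i)))) ||
    (b.h₁ (fun i => y (Fin.natAdd _ (Fin.castAdd _ i))) ==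
      b.h₂ (fun i => y (Fin.natAdd _ (Fin.natAdd _ i))))
  h₂ _ := true
  g := Fin.append
    (Fin.append (fun i x => a.g i (fun j => x (Fin.castAdd _ j)))
      (fun i x => a.g' i (fun j => x (Fin.castAdd _ j))))
    (Fin.append (fun i x => b.g i (fun j => x (Fin.natAdd _ j)))
      (fun i x => b.g' i (fun j => x (Fin.natAdd _ j))))
  g' _ _ := true

theorem BoolFun.satisfies_or (f : BoolFun) (a b : FunctionalEquation) :
    f.Satisfies (a.or b) ↔ f.Satisfies a ∨ f.Satisfies b := by
  have key : f.Satisfies (a.or b) ↔ ∀ (v : Fin (a.p + b.p) → Fin f.arity → Bool),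
      (a.h₁ (fun i => f.toFun (fun k => a.g i (fun j => v (Fin.castAdd _ j) k))) =
        a.h₂ (fun i => f.toFun (fun k => a.g' i (fun j => v (Fin.castAdd _ j) k)))) ∨
      (b.h₁ (fun i => f.toFun (fun k => b.g i (fun j => v (Fin.natAdd _ j) k))) =
        b.h₂ (fun i => f.toFun (fun k => b.g' i (fun j => v (Fin.natAdd _ j) k)))) := by
    refine forall_congr' fun v => ?_
    simp [FunctionalEquation.or, Fin.append_left, Fin.append_right]
  rw [key]
  constructor
  · intro h
    by_contra hcon
    simp only [not_or, BoolFun.Satisfies, not_forall] at hcon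
    obtain ⟨⟨v, hv⟩, ⟨w, hw⟩⟩ := hcon
    have := h (Fin.append v w)
    simp only [Fin.append_left, Fin.append_right] at this
    exact this.elim hv hw
  · rintro (h | h) v
    · exact Or.inl (h fun j => v (Fin.castAdd _ j))
    · exact Or.inr (h fun j => v (Fin.natAdd _ j))

theorem FinitelyDefinable.inter {K L : Set BoolFun} (hK : FinitelyDefinable K)
    (hL : FinitelyDefinable L) : FinitelyDefinable (K ∩ L) := by
  obtain ⟨E, hE, rfl⟩ := hK
  obtain ⟨E', hE', rfl⟩ := hL
  refine ⟨E ∪ E', hE.union hE', ?_⟩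
  ext f
  simp only [definedBy, Set.mem_union, Set.mem_ofPred_eq, Set.mem_inter_iff]
  exact ⟨fun h => ⟨fun e he => h e (Or.inl he), fun e he => h e (Or.inr he)⟩,
    fun h e he => he.elim (h.1 e) (h.2 e)⟩

theorem FinitelyDefinable.union {K L : Set BoolFun} (hK : FinitelyDefinable K)
    (hL : FinitelyDefinable L) : FinitelyDefinable (K ∪ L) := by
  obtain ⟨E, hE, rfl⟩ := hK
  obtain ⟨E', hE', rfl⟩ := hL
  refine ⟨Set.image2 FunctionalEquation.or E E', hE.image2 _ hE', ?_⟩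
  ext f
  simp only [definedBy, Set.mem_ofPred_eq, Set.mem_union, Set.forall_mem_image2,
    BoolFun.satisfies_or]
  constructor
  · intro h
    by_contra hcon
    simp only [not_or, not_forall] at hcon
    obtain ⟨⟨a, ha, hfa⟩, ⟨b, hb, hfb⟩⟩ := hcon
    exact (h a ha b hb).elim hfa hfb
  · rintro (h | h) a ha b hb
    · exact Or.inl (h a ha)
    · exact Or.inr (h b hb)

theorem FinitelyDefinable.univ : FinitelyDefinable Set.univ :=
  ⟨∅, Set.finite_empty, by ext f; simp [definedBy]⟩

theorem FinitelyDefinable.empty : FinitelyDefinable ∅ := by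
  refine ⟨{⟨1, 1, 1, le_rfl, le_rfl, le_rfl, fun _ => true, fun _ => false,
    fun _ _ => true, fun _ _ => true⟩}, Set.finite_singleton _, ?_⟩
  ext f
  simp [definedBy, BoolFun.Satisfies]

/-- The lattice `𝓕`, ordered by inclusion, of the classes of Boolean functions which can be defined
by finitely many functional equations; joins and meets are unions and intersections. -/
def finDefClasses : Sublattice (Set BoolFun) where
  carrier := {K | FinitelyDefinable K}
  supClosed' _ hK _ hL := FinitelyDefinable.union hK hL
  infClosed' _ hK _ hL := FinitelyDefinable.inter hK hL

instance : BoundedOrder finDefClasses where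
  top := ⟨Set.univ, FinitelyDefinable.univ⟩
  le_top K := Set.subset_univ K.1
  bot := ⟨∅, FinitelyDefinable.empty⟩
  bot_le K := Set.empty_subset K.1

/-- The product topology on the power set `𝔓(X) = {0,1}^X`, where the two-element set of truth
values is discrete. (The default topology on `Prop` is the Sierpiński one, which is not meant.) -/
@[reducible]
def powersetTopology (X : Type*) : TopologicalSpace (Set X) :=
  TopologicalSpace.induced (fun (S : Set X) (x : X) => x ∈ S)
    (@Pi.topologicalSpace X (fun _ => Prop) (fun _ => ⊥))

/-- The underlying set of the Priestley space of a bounded distributive lattice `T`: the prime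
filters of `T`. Its order is the inclusion order. -/
abbrev PriestleySpectrum (T : Type*) [DistribLattice T] [BoundedOrder T] : Type _ :=
  {G : Order.PFilter T // G.IsPrime}

/-- The topology on the Priestley space of `T`, induced by the product topology on `𝔓(T)`. -/
instance (T : Type*) [DistribLattice T] [BoundedOrder T] :
    TopologicalSpace (PriestleySpectrum T) :=
  TopologicalSpace.induced (fun G => (G.1 : Set T)) (powersetTopology T)

/-- The topology on the set of ideals of a poset `P`, induced by the product topology on `𝔓(P)`. -/
instance (P : Type*) [PartialOrder P] : TopologicalSpace (Order.Ideal P) :=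
  TopologicalSpace.induced (fun J => (J : Set P)) (powersetTopology P)

/-! ### Simple variable substitution and functional equations -/

/-! The classes `avoidClass f`, complements of principal up-sets, generate `𝓕` under finite
intersection (`exists_finset_eq_inf_avoidClass`): one equation defines each of them, and a failure
of an equation in `p` variables is already visible in a minor of arity `2 ^ p`, of which there are
finitely many. Intersections are joins in the reverse order, so a prime filter containing a finite
intersection of such classes contains one of them. It is therefore determined by the `f` with
`avoidClass f` in it, and these form an ideal. For the same reason each membership condition on one
side is a finite union of such conditions on the other, which gives the homeomorphism. -/

theorem BoolFun.Satisfies.mono {f g : BoolFun} {e : FunctionalEquation} (h : f.Satisfies e)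
    (hgf : g ≤ f) : g.Satisfies e := by
  obtain ⟨σ, hσ⟩ := hgf
  intro v
  simpa only [hσ, boolProj] using h fun j k => v j (σ k)

theorem FinitelyDefinable.isLowerSet {K : Set BoolFun} (hK : FinitelyDefinable K) :
    IsLowerSet K := by
  obtain ⟨E, -, rfl⟩ := hK
  exact fun f g hgf hf e he => (hf e he).mono hgf

/-- The equation satisfied by exactly those `h` of which `f` is not a minor: the vector variables
of an instance encode a substitution of variables, and the equation says that the resulting function
differs from `f` somewhere. -/
noncomputable def BoolFun.avoidEquation (f : BoolFun) : FunctionalEquation where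
  m := Fintype.card (Fin f.arity → Bool)
  t := 1
  p := f.arity
  m_pos := Fintype.card_pos
  t_pos := le_rfl
  p_pos := f.arity_pos
  h₁ y := decide (∀ a, y (Fintype.equivFin _ a) = f.toFun a)
  h₂ _ := false
  -- `invFun` decodes a unit vector to its index; any other `x` gets some index too, so every
  -- instance encodes a substitution.
  g i x := (Fintype.equivFin (Fin f.arity → Bool)).symm i
    (have : Nonempty (Fin f.arity) := ⟨⟨0, f.arity_pos⟩⟩
     Function.invFun (fun i j : Fin f.arity => decide (j = i)) x)
  g' _ _ := true

theorem BoolFun.satisfies_avoidEquation (f h : BoolFun) :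
    h.Satisfies f.avoidEquation ↔ ¬ f ≤ h := by
  have : Nonempty (Fin f.arity) := ⟨⟨0, f.arity_pos⟩⟩
  have hinj : Function.Injective (fun i j : Fin f.arity => decide (j = i)) := by
    intro i i' hii
    simpa using congrFun hii i
  simp only [BoolFun.Satisfies, avoidEquation, decide_eq_false_iff_not, Equiv.symm_apply_apply]
  constructor
  · rintro H ⟨σ, hσ⟩
    refine H (fun j k => decide (j = σ k)) fun a => ?_
    rw [hσ]
    congr 1
    funext k
    exact congrArg a (Function.leftInverse_invFun hinj (σ k))
  · exact fun H v hv => H ⟨fun k => Function.invFun _ fun j => v j k, fun a => (hv a).symm⟩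

/-- The class of the functions of which `f` is not a minor, as an element of `𝓕`. -/
noncomputable def avoidClass (f : BoolFun) : finDefClasses :=
  ⟨{h | ¬ f ≤ h}, {f.avoidEquation}, Set.finite_singleton _, by
    ext h; simp [definedBy, BoolFun.satisfies_avoidEquation]⟩

theorem notMem_avoidClass {f h : BoolFun} : h ∉ (avoidClass f : Set BoolFun) ↔ f ≤ h :=
  not_not

theorem le_avoidClass {K : finDefClasses} {f : BoolFun} (hf : f ∉ (K : Set BoolFun)) :
    K ≤ avoidClass f :=
  fun _ hh hfh => hf (K.2.isLowerSet hfh hh)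

theorem avoidClass_mono {f g : BoolFun} (h : f ≤ g) : avoidClass f ≤ avoidClass g :=
  fun _ hk hgk => hk (h.trans hgk)

/-- A function failing an equation in `p` variables has a minor of arity `2 ^ p` failing it. -/
theorem exists_le_arity_not_satisfies {h : BoolFun} {e : FunctionalEquation}
    (hh : ¬ h.Satisfies e) :
    ∃ φ, (⟨Fintype.card (Fin e.p → Bool), Fintype.card_pos, φ⟩ : BoolFun) ≤ h ∧
      ¬ BoolFun.Satisfies ⟨Fintype.card (Fin e.p → Bool), Fintype.card_pos, φ⟩ e := by
  simp only [BoolFun.Satisfies, not_forall] at hh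
  obtain ⟨v, hv⟩ := hh
  let ε := Fintype.equivFin (Fin e.p → Bool)
  -- Variables of `h` at which the failing instance `v` has the same column are identified; the
  -- minor has one variable for each possible column.
  refine ⟨fun a => h.toFun fun k => a (ε fun j => v j k), ⟨fun k => ε fun j => v j k, fun _ => rfl⟩,
    fun H => hv ?_⟩
  simpa only [Equiv.symm_apply_apply] using H fun j i => ε.symm i j

theorem exists_finset_eq_inf_avoidClass (K : finDefClasses) :
    ∃ S : Finset BoolFun, K = S.inf avoidClass := by
  obtain ⟨E, hE, hK⟩ := K.2
  let N (e : FunctionalEquation) (φ : (Fin (Fintype.card (Fin e.p → Bool)) → Bool) → Bool) :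
    BoolFun := ⟨_, Fintype.card_pos, φ⟩
  have hfin : (⋃ e ∈ E, Set.range (N e) ∩ {f | ¬ f.Satisfies e}).Finite :=
    hE.biUnion fun e _ => (Set.finite_range _).inter_of_left _
  refine ⟨hfin.toFinset, le_antisymm (Finset.le_inf fun f hf => le_avoidClass fun hfK => ?_) ?_⟩
  · simp only [Set.Finite.mem_toFinset, Set.mem_iUnion] at hf
    obtain ⟨e, he, -, hfe⟩ := hf
    rw [← hK] at hfK
    exact hfe (hfK e he)
  · intro h hh
    by_contra hhK
    rw [← hK] at hhK
    simp only [definedBy, Set.mem_ofPred_eq, not_forall] at hhK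
    obtain ⟨e, he, hhe⟩ := hhK
    obtain ⟨φ, hφ, hφe⟩ := exists_le_arity_not_satisfies hhe
    have hmem : N e φ ∈ hfin.toFinset := by
      simp only [Set.Finite.mem_toFinset, Set.mem_iUnion]
      exact ⟨e, he, ⟨φ, rfl⟩, hφe⟩
    exact (Finset.inf_le hmem : _ ≤ avoidClass (N e φ)) hh hφ

theorem notMem_finset_inf_avoidClass {S : Finset BoolFun} {h : BoolFun} :
    h ∉ ((S.inf avoidClass : finDefClasses) : Set BoolFun) ↔ ∃ f ∈ S, f ≤ h := by
  classical
  induction S using Finset.induction_on with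
  | empty => exact iff_of_false (not_not.2 (Set.mem_univ h)) (by simp)
  | insert f S _ ih =>
    rw [Finset.inf_insert, Finset.exists_mem_insert, ← ih, ← notMem_avoidClass]
    exact not_and_or

/-! ### Ideals and prime filters -/

local notation "cls" => toAntisymmetrization (α := BoolFun) (· ≤ ·)

theorem mem_ideal_of_le {J : Order.Ideal BoolFunClasses} {f g : BoolFun} (h : f ≤ g)
    (hg : cls g ∈ J) : cls f ∈ J :=
  J.lower (toAntisymmetrization_le_toAntisymmetrization_iff.2 h) hg

theorem exists_cls_mem (J : Order.Ideal BoolFunClasses) : ∃ f, cls f ∈ J := by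
  obtain ⟨x, hx⟩ := J.nonempty
  induction x using Quotient.inductionOn with
  | h f => exact ⟨f, hx⟩

/-- An ideal `J` meets the complement of `K`. -/
def Meets (J : Order.Ideal BoolFunClasses) (K : finDefClasses) : Prop :=
  ∃ f : BoolFun, cls f ∈ J ∧ f ∉ (K : Set BoolFun)

theorem meets_avoidClass {J : Order.Ideal BoolFunClasses} {f : BoolFun} :
    Meets J (avoidClass f) ↔ cls f ∈ J :=
  ⟨fun ⟨_, hg, hfg⟩ => mem_ideal_of_le (notMem_avoidClass.1 hfg) hg,
    fun h => ⟨f, h, notMem_avoidClass.2 le_rfl⟩⟩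

theorem meets_finset_inf {J : Order.Ideal BoolFunClasses} {S : Finset BoolFun} :
    Meets J (S.inf avoidClass) ↔ ∃ f ∈ S, cls f ∈ J := by
  simp only [Meets, notMem_finset_inf_avoidClass]
  exact ⟨fun ⟨_, hg, f, hf, hfg⟩ => ⟨f, hf, mem_ideal_of_le hfg hg⟩,
    fun ⟨f, hf, h⟩ => ⟨f, h, f, hf, le_rfl⟩⟩

/-- The prime filter of the classes whose complement an ideal meets. -/
def primeFilterOfIdeal (J : Order.Ideal BoolFunClasses) :
    PriestleySpectrum (finDefClasses)ᵒᵈ := by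
  have hF : Order.IsPFilter {K : (finDefClasses)ᵒᵈ | Meets J (OrderDual.ofDual K)} := by
    refine Order.IsPFilter.of_def ?_ ?_ ?_
    · obtain ⟨f, hf⟩ := exists_cls_mem J
      exact ⟨OrderDual.toDual (avoidClass f), meets_avoidClass.2 hf⟩
    · rintro K ⟨f, hf, hfK⟩ L ⟨g, hg, hgL⟩
      obtain ⟨x, hx, hfx, hgx⟩ := J.directed _ hf _ hg
      induction x using Quotient.inductionOn with
      | h k =>
        have hfk : f ≤ k := toAntisymmetrization_le_toAntisymmetrization_iff.1 hfx
        have hgk : g ≤ k := toAntisymmetrization_le_toAntisymmetrization_iff.1 hgx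
        -- In the dual order `⊓` is union and, below, `⊥` is `Set.univ` and `⊔` is intersection.
        refine ⟨K ⊓ L, ⟨k, hx, ?_⟩, inf_le_left, inf_le_right⟩
        rintro (hk | hk)
        · exact hfK ((OrderDual.ofDual K).2.isLowerSet hfk hk)
        · exact hgL ((OrderDual.ofDual L).2.isLowerSet hgk hk)
    · rintro K L hKL ⟨f, hf, hfK⟩
      exact ⟨f, hf, fun hfL => hfK (hKL hfL)⟩
  refine ⟨hF.toPFilter, ⟨Order.IsIdeal.mk ?_ ?_ ?_⟩⟩
  · intro K L hLK hK hL
    exact hK (hF.toPFilter.mem_of_le hLK hL)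
  · exact ⟨⊥, fun ⟨f, _, hf⟩ => hf (Set.mem_univ f)⟩
  · intro K hK L hL
    refine ⟨K ⊔ L, fun ⟨f, hf, hfKL⟩ => ?_, le_sup_left, le_sup_right⟩
    rcases not_and_or.1 hfKL with h | h
    · exact hK ⟨f, hf, h⟩
    · exact hL ⟨f, hf, h⟩

theorem mem_primeFilterOfIdeal {J : Order.Ideal BoolFunClasses} {K : finDefClasses} :
    OrderDual.toDual K ∈ (primeFilterOfIdeal J).1 ↔ Meets J K :=
  Iff.rfl

theorem exists_avoidClass_mem (G : PriestleySpectrum (finDefClasses)ᵒᵈ) {S : Finset BoolFun}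
    (hS : OrderDual.toDual (S.inf avoidClass) ∈ G.1) :
    ∃ f ∈ S, OrderDual.toDual (avoidClass f) ∈ G.1 := by
  classical
  have hI := G.2.compl_ideal
  induction S using Finset.induction_on with
  | empty =>
    obtain ⟨K, hK⟩ := hI.Nonempty
    -- The empty infimum is `Set.univ`, the bottom of the dual, which a proper filter omits.
    exact absurd (G.1.mem_of_le bot_le hS) hK
  | insert f S _ ih =>
    rw [Finset.exists_mem_insert]
    by_contra! hcon
    have hS' : OrderDual.toDual (S.inf avoidClass) ∉ G.1 := fun h =>
      let ⟨g, hg, hgG⟩ := ih h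
      hcon.2 g hg hgG
    obtain ⟨L, hL, hfL, hSL⟩ := hI.Directed _ hcon.1 _ hS'
    refine hL (G.1.mem_of_le (sup_le hfL hSL) ?_)
    rwa [Finset.inf_insert] at hS

/-- The functions `f` for which a prime filter contains `avoidClass f` form an ideal. -/
theorem exists_ideal_forall_cls_mem_iff (G : PriestleySpectrum (finDefClasses)ᵒᵈ) :
    ∃ J : Order.Ideal BoolFunClasses,
      ∀ f, cls f ∈ J ↔ OrderDual.toDual (avoidClass f) ∈ G.1 := by
  have hG {f g : BoolFun} (h : f ≤ g) (hg : OrderDual.toDual (avoidClass g) ∈ G.1) :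
      OrderDual.toDual (avoidClass f) ∈ G.1 :=
    G.1.mem_of_le (OrderDual.toDual_le_toDual.2 (avoidClass_mono h)) hg
  have hI : Order.IsIdeal (toAntisymmetrization (· ≤ ·) ''
      {f : BoolFun | OrderDual.toDual (avoidClass f) ∈ G.1}) := by
    refine ⟨?_, ?_, ?_⟩
    · rintro _ y hyx ⟨f, hf, rfl⟩
      induction y using Quotient.inductionOn with
      | h g => exact ⟨g, hG (toAntisymmetrization_le_toAntisymmetrization_iff.1 hyx) hf, rfl⟩
    · obtain ⟨K, hK⟩ := G.1.nonempty
      obtain ⟨S, hS⟩ := exists_finset_eq_inf_avoidClass (OrderDual.ofDual K)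
      have hK' : OrderDual.toDual (S.inf avoidClass) ∈ G.1 := hS ▸ hK
      obtain ⟨f, -, hf⟩ := exists_avoidClass_mem G hK'
      exact ⟨_, f, hf, rfl⟩
    · rintro _ ⟨f, hf, rfl⟩ _ ⟨g, hg, rfl⟩
      -- Rewriting this union as a finite intersection lets primeness select a single `k`, which
      -- bounds `f` and `g` because `k ∉ avoidClass k`.
      obtain ⟨S, hS⟩ := exists_finset_eq_inf_avoidClass (avoidClass f ⊔ avoidClass g)
      have hfg : OrderDual.toDual (S.inf avoidClass) ∈ G.1 := hS ▸ Order.PFilter.inf_mem hf hg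
      obtain ⟨k, hkS, hk⟩ := exists_avoidClass_mem G hfg
      have hle : avoidClass f ⊔ avoidClass g ≤ avoidClass k := hS.le.trans (Finset.inf_le hkS)
      refine ⟨_, ⟨k, hk, rfl⟩, ?_, ?_⟩
      · exact toAntisymmetrization_le_toAntisymmetrization_iff.2
          (by_contra fun h => le_sup_left.trans hle h le_rfl)
      · exact toAntisymmetrization_le_toAntisymmetrization_iff.2
          (by_contra fun h => le_sup_right.trans hle h le_rfl)
  refine ⟨hI.toIdeal, fun f => ⟨?_, fun hf => ⟨f, hf, rfl⟩⟩⟩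
  rintro ⟨g, hg, hgf⟩
  exact hG (toAntisymmetrization_le_toAntisymmetrization_iff.1 hgf.ge) hg

theorem primeFilterOfIdeal_le_iff {I J : Order.Ideal BoolFunClasses} :
    primeFilterOfIdeal I ≤ primeFilterOfIdeal J ↔ I ≤ J := by
  constructor
  · intro h x hx
    induction x using Quotient.inductionOn with
    | h f =>
      have hf : OrderDual.toDual (avoidClass f) ∈ (primeFilterOfIdeal I).1 :=
        meets_avoidClass.2 hx
      exact meets_avoidClass.1 (h hf)
  · rintro h K ⟨f, hf, hfK⟩
    exact ⟨f, h hf, hfK⟩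

theorem primeFilterOfIdeal_surjective : Function.Surjective primeFilterOfIdeal := by
  intro G
  obtain ⟨J, hJ⟩ := exists_ideal_forall_cls_mem_iff G
  refine ⟨J, Subtype.ext (SetLike.ext fun K => ?_)⟩
  obtain ⟨S, hS⟩ := exists_finset_eq_inf_avoidClass (OrderDual.ofDual K)
  obtain rfl : K = OrderDual.toDual (S.inf avoidClass) := hS
  rw [mem_primeFilterOfIdeal, meets_finset_inf]
  simp only [hJ]
  refine ⟨fun ⟨f, hfS, hf⟩ => G.1.mem_of_le ?_ hf, exists_avoidClass_mem G⟩
  exact OrderDual.toDual_le_toDual.2 (Finset.inf_le hfS)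

/-- Ideals of `(Ω/≡, ⊑)` correspond to prime filters of `𝓕` ordered by reverse inclusion. -/
noncomputable def idealOrderIso :
    Order.Ideal BoolFunClasses ≃o PriestleySpectrum (finDefClasses)ᵒᵈ :=
  RelIso.ofSurjective (OrderEmbedding.ofMapLEIff primeFilterOfIdeal
    fun _ _ => primeFilterOfIdeal_le_iff) primeFilterOfIdeal_surjective

theorem mem_idealOrderIso {J : Order.Ideal BoolFunClasses} {K : finDefClasses} :
    OrderDual.toDual K ∈ (idealOrderIso J).1 ↔ Meets J K :=
  Iff.rfl

/-! ### Topology -/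

theorem continuous_powersetTopology_iff {X Y : Type*} [TopologicalSpace X] {F : X → Set Y} :
    @Continuous X (Set Y) _ (powersetTopology Y) F ↔ ∀ y, IsClopen {x | y ∈ F x} := by
  let _ : TopologicalSpace Prop := ⊥
  have : DiscreteTopology Prop := ⟨rfl⟩
  rw [powersetTopology, continuous_induced_rng, continuous_pi_iff]
  refine forall_congr' fun y => ?_
  rw [continuous_discrete_rng]
  have h₁ : (fun x => y ∈ F x) ⁻¹' {True} = {x | y ∈ F x} := by
    ext x; simp
  have h₂ : (fun x => y ∈ F x) ⁻¹' {False} = {x | y ∈ F x}ᶜ := by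
    ext x; simp
  constructor
  · intro h
    refine ⟨⟨?_⟩, ?_⟩
    · exact h₂ ▸ h False
    · exact h₁ ▸ h True
  · intro h p
    by_cases hp : p
    · rw [eq_true hp]
      exact h₁ ▸ h.isOpen
    · rw [eq_false hp]
      exact h₂ ▸ h.compl.isOpen

theorem isClopen_setOf_mem_ideal {P : Type*} [PartialOrder P] (x : P) :
    IsClopen {J : Order.Ideal P | x ∈ J} :=
  continuous_powersetTopology_iff.1 continuous_induced_dom x

theorem isClopen_setOf_mem_primeFilter {T : Type*} [DistribLattice T] [BoundedOrder T] (x : T) :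
    IsClopen {G : PriestleySpectrum T | x ∈ G.1} :=
  continuous_powersetTopology_iff.1 continuous_induced_dom x

theorem continuous_idealOrderIso : Continuous idealOrderIso := by
  refine continuous_induced_rng.2 (continuous_powersetTopology_iff.2 fun K => ?_)
  obtain ⟨S, hS⟩ := exists_finset_eq_inf_avoidClass (OrderDual.ofDual K)
  obtain rfl : K = OrderDual.toDual (S.inf avoidClass) := hS
  -- Finiteness of `S` is what keeps this union closed as well as open.
  have h : {J | OrderDual.toDual (S.inf avoidClass) ∈ (idealOrderIso J).1} =
      ⋃ f ∈ S, {J | cls f ∈ J} := by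
    ext J
    simp only [Set.mem_ofPred_eq, Set.mem_iUnion, mem_idealOrderIso, meets_finset_inf, exists_prop]
  exact h ▸ isClopen_biUnion_finset fun f _ => isClopen_setOf_mem_ideal _

theorem continuous_idealOrderIso_symm : Continuous idealOrderIso.symm := by
  refine continuous_induced_rng.2 (continuous_powersetTopology_iff.2 fun x => ?_)
  induction x using Quotient.inductionOn with
  | h f =>
    have h : {G | cls f ∈ idealOrderIso.symm G} =
        {G | OrderDual.toDual (avoidClass f) ∈ G.1} := by
      ext G
      obtain ⟨J, rfl⟩ := idealOrderIso.surjective G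
      simp only [Set.mem_ofPred_eq, OrderIso.symm_apply_apply, mem_idealOrderIso, meets_avoidClass]
    exact h ▸ isClopen_setOf_mem_primeFilter _

/-- The Priestley space of `𝓕` ordered by reverse inclusion is isomorphic, as an ordered topological
space, to the set of ideals of `(Ω/≡, ⊑)`; the isomorphism sends an ideal `J` to the prime filter of
all `K ∈ 𝓕` which omit some function whose class is in `J`. -/
theorem theorem2 :
    ∃ e : Order.Ideal BoolFunClasses ≃o PriestleySpectrum (finDefClasses)ᵒᵈ,
      IsHomeomorph e ∧
      ∀ (J : Order.Ideal BoolFunClasses) (K : finDefClasses),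
        OrderDual.toDual K ∈ (e J).1 ↔
          ∃ f : BoolFun, toAntisymmetrization (· ≤ ·) f ∈ J ∧ f ∉ (K : Set BoolFun) :=
  ⟨idealOrderIso,
    (Homeomorph.mk idealOrderIso.toEquiv continuous_idealOrderIso
      continuous_idealOrderIso_symm).isHomeomorph,
    fun _ _ => mem_idealOrderIso⟩
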